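/- **5/6-Lemma.** A parametric one-counter automaton (POCA) with one parameter $p$ is a tuple $\mathcal C=(Q,\{p\},R,q_{init},F)$ with a non-empty finite set $Q$ of control states, $q_{init}\in Q$, $F\subseteq Q$, and a finite set $R\subseteq Q\times \mathsf{Op}\times Q$ of rules. The set $\mathsf{Op}$ consists of the operations $-1,0,+1$, $+p$, $-p$, $\mathsf{mod}\ c$, $\bowtie c$ and $\bowtie p$, where $c\in\mathbb N=\{0,1,\dots\}$ and $\bowtie\,\in\{<,\le,=,\ge,>\}$. Assume that $c\neq 0$ for every operation $\mathsf{mod}\ c$ occurring in $R$. Let $\mathsf{Consts}(\mathcal C)$ be the set of all constants $c$ that occur in operations $\mathsf{mod}\ c$ or $\bowtie c$ of rules in $R$. For a finite set $S\subseteq\mathbb N$ let $\mathsf{LCM}(S)$ be the least $n\ge 1$ divisible by all $m\in S\setminus\{0\}$, and for $j\in\mathbb N$ let $\mathsf{LCM}(j)=\mathsf{LCM}(\{1,\dots,j\})$. Put $$Z_{\mathcal C}=\mathsf{LCM}(\mathsf{Consts}(\mathcal C)),\qquad \Gamma_{\mathcal C}=\mathsf{LCM}(17|Q|)\cdot Z_{\mathcal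 C},$$ $$\Upsilon_{\mathcal C}=17|Q|\cdot\mathsf{LCM}(17|Q|)\cdot(17|Q|\cdot Z_{\mathcal C}+2),\qquad M_{\mathcal C}=30\,(\Upsilon_{\mathcal C}+\Gamma_{\mathcal C}+1).$$ A configuration $q(z)$ is a pair $(q,z)\in Q\times\mathbb Z$. For $N\in\mathbb N$, an $N$-semirun $\pi$ from $q_0(z_0)$ to $q_n(z_n)$, $n\ge0$, is a sequence of configurations $q_0(z_0),\dots,q_n(z_n)$ together with operations $\pi_0,\dots,\pi_{n-1}$ such that for all $0\le i<n$ we have $(q_i,\pi_i,q_{i+1})\in R$ and: $z_{i+1}=z_i+\pi_i$ if $\pi_i\in\{-1,0,1\}$; $z_{i+1}=z_i\pm N$ if $\pi_i=\pm p$; $z_{i+1}=z_i$ and $c\mid z_i$ if $\pi_i=\mathsf{mod}\ c$; and $z_{i+1}=z_i$ if $\pi_i$ is a comparison $\bowtie c$ or $\bowtie p$ (the comparison itself need not hold). Let $\mathrm{Values}(\pi)=\{z_0,\dots,z_n\}$, and let $\min(\pi)$ and $\max(\pi)$ be its minimum and maximum. For $\ell\in\mathbb Z$, an $N'$-semirun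 $\sigma$ with configurations $s_0(y_0),\dots,s_m(y_m)$ and operations $\sigma_0,\dots,\sigma_{m-1}$ is an $\ell$-embedding of $\pi$ if $s_0=q_0$, $s_m=q_n$, and there is a strictly increasing map $\psi:\{0,\dots,m\}\to\{0,\dots,n\}$ such that $\sigma_i=\pi_{\psi(i)}$ for all $0\le i<m$, and, for all $0\le i\le m$ and each $\bowtie\,\in\{<,=,>\}$, $\ell\bowtie y_i$ if and only if $\ell\bowtie z_{\psi(i)}$. **Claim.** For all integers $N>M_{\mathcal C}$, all $\ell\in\mathbb Z$, and all $N$-semiruns $\pi$ from $q_0(z_0)$ to $q_n(z_n)$ with $\mathrm{Values}(\pi)\subseteq[0,4N]$ and $$\max(z_0,z_n,\ell)-\min(z_0,z_n,\ell)\le \tfrac56 N,$$ there exists an $(N-\Gamma_{\mathcal C})$-semirun $\pi'$ from $q_0(z_0)$ to $q_n(z_n)$ that is an $\ell$-embedding of $\pi$ and satisfies $\mathrm{Values}(\pi')\subseteq[\min(\pi)-\Gamma_{\mathcal C},\max(\pi)+\Gamma_{\mathcal C}]$. -/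

import Mathlib

namespace FiveSixth

/-- The comparison symbols `<, ≤, =, ≥, >`. -/
inductive Cmp : Type
  | lt | le | eq | ge | gt

/-- Operations over a set `P` of parameters: the updates `-1, 0, +1` (an element of `SignType`),
the parametric updates `+p` and `-p`, the divisibility tests `mod c`, and the comparison tests
against a constant or a parameter. -/
inductive Op (P : Type*) : Type _
  | upd (c : SignType)
  | addParam (p : P)
  | subParam (p : P)
  | modTest (c : ℕ)
  | cmpConst (r : Cmp) (c : ℕ)
  | cmpParam (r : Cmp) (p : P)

/-- The constants that appear in an operation (in divisibility and comparison tests). -/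
def Op.consts {P : Type*} : Op P → Finset ℕ
  | .modTest c => {c}
  | .cmpConst _ c => {c}
  | _ => ∅

/-- A parametric one-counter automaton with control states `Q` and parameters `P`. -/
structure POCA (Q P : Type*) where
  rules : Finset (Q × Op P × Q)
  init : Q
  final : Set Q

/-- The least positive integer that is divisible by all nonzero elements of `S`. -/
def lcmSet (S : Finset ℕ) : ℕ := (S.erase 0).lcm id

/-- `LCM(j) = LCM([1, j])`. -/
def lcmUpTo (j : ℕ) : ℕ := lcmSet (Finset.Icc 1 j)

namespace POCA

variable {Q P : Type*}

/-- The constants that appear in the rules. -/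
def consts (C : POCA Q P) : Finset ℕ := C.rules.biUnion fun r => r.2.1.consts

/-- `Z_C = LCM(Consts(C))`. -/
def Z (C : POCA Q P) : ℕ := lcmSet C.consts

/-- `Γ_C = LCM(17 |Q|) · Z_C`. -/
def Gam [Fintype Q] (C : POCA Q P) : ℕ := lcmUpTo (17 * Fintype.card Q) * C.Z

/-- `Υ_C = 17 |Q| · LCM(17 |Q|) · (17 |Q| · Z_C + 2)`. -/
def Ups [Fintype Q] (C : POCA Q P) : ℕ :=
  17 * Fintype.card Q * lcmUpTo (17 * Fintype.card Q) * (17 * Fintype.card Q * C.Z + 2)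

/-- `M_C = 30 · (Υ_C + Γ_C + 1)`. -/
def M [Fintype Q] (C : POCA Q P) : ℕ := 30 * (C.Ups + C.Gam + 1)

/-- The effect on the counter that a semitransition with operation `op` allows: updates and
divisibility tests are respected, whereas comparison tests only keep the counter unchanged. -/
def OpSemiStep (μ : P → ℕ) : Op P → ℤ → ℤ → Prop
  | .upd c, z, z' => z' = z + (c : ℤ)
  | .addParam p, z, z' => z' = z + (μ p : ℤ)
  | .subParam p, z, z' => z' = z - (μ p : ℤ)
  | .modTest c, z, z' => z = z' ∧ (c : ℤ) ∣ z'
  | .cmpConst _ _, z, z' => z = z'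
  | .cmpParam _ _, z, z' => z = z'

/-- The semitransition `q(z) ⇝ q'(z')` with operation `op` under the valuation `μ`.
A configuration `q(z)` is the pair `(q, z)`. -/
def SemiStep (C : POCA Q P) (μ : P → ℕ) (op : Op P) (c c' : Q × ℤ) : Prop :=
  (c.1, op, c'.1) ∈ C.rules ∧ OpSemiStep μ op c.2 c'.2

end POCA

/-- A `μ`-semirun: configurations with indices `0, …, len`, linked by semitransitions. -/
structure Semirun {Q P : Type*} (C : POCA Q P) (μ : P → ℕ) where
  len : ℕ
  conf : Fin (len + 1) → Q × ℤ
  op : Fin len → Op P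
  step : ∀ i : Fin len, C.SemiStep μ (op i) (conf i.castSucc) (conf i.succ)

/-- An `N`-semirun of a POCA with a single parameter. -/
abbrev NSemirun {Q P : Type*} [Unique P] (C : POCA Q P) (N : ℕ) := Semirun C (fun _ : P => N)

namespace Semirun

variable {Q P : Type*} {C : POCA Q P} {μ ν : P → ℕ}

/-- The source configuration. -/
def source (π : Semirun C μ) : Q × ℤ := π.conf 0

/-- The target configuration. -/
def target (π : Semirun C μ) : Q × ℤ := π.conf (Fin.last π.len)

/-- The set of counter values of the configurations. -/
def values (π : Semirun C μ) : Finset ℤ := Finset.univ.image fun i => (π.conf i).2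

theorem values_nonempty (π : Semirun C μ) : π.values.Nonempty :=
  Finset.univ_nonempty.image _

/-- The least counter value. -/
def min (π : Semirun C μ) : ℤ := π.values.min' π.values_nonempty

/-- The greatest counter value. -/
def max (π : Semirun C μ) : ℤ := π.values.max' π.values_nonempty

/-- `σ` is an `ℓ`-embedding of `π`. -/
def IsEmbedding (ℓ : ℤ) (σ : Semirun C μ) (π : Semirun C ν) : Prop :=
  σ.source.1 = π.source.1 ∧ σ.target.1 = π.target.1 ∧
  ∃ ψ : Fin (σ.len + 1) → Fin (π.len + 1), StrictMono ψ ∧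
    (∀ i : Fin σ.len, ∃ j : Fin π.len, ψ i.castSucc = j.castSucc ∧ σ.op i = π.op j) ∧
    ∀ i, (ℓ < (σ.conf i).2 ↔ ℓ < (π.conf (ψ i)).2) ∧
         (ℓ = (σ.conf i).2 ↔ ℓ = (π.conf (ψ i)).2) ∧
         (ℓ > (σ.conf i).2 ↔ ℓ > (π.conf (ψ i)).2)

end Semirun

end FiveSixth

/-! ### Drift paths and the skipping of loops. -/

namespace FiveSixth

/-! Let `h` be the net number of additions of the parameter so far. The drift `d = z - N * h` moves
by at most one per step. Lowering `N` by `Γ = L * Z` turns `z` into `z - h * Γ + c`, where `c` is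
minus the total drift of the loops cut out so far. The target is met exactly when `c` ends at `h *
Γ`.

If `d = ℓ + N * j + w` with `|w| ≤ N - E` and `c = -j * Γ`, the value moves from `ℓ + N * (h + j) +
w` to `ℓ + (N - Γ) * (h + j) + w`, on the same side of `ℓ` (`ok_near`). So `c` should follow the
multiple of `N` that `d - ℓ` is close to. Strictly between two multiples every intermediate `c` is
harmless (`ok_between`), so `c` can change by `Γ` while the drift crosses the band.

In a band, values in `[0, 4N]` allow at most 17 heights. Pigeonhole on pairs of state and height
gives many height-preserving loops of one common drift `±Z * d` with `d ∣ L`, and `L / d` of them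
make up `Γ` (`reach_shift`). Corrections stay multiples of `Z`, so divisibility tests survive. Which
`c` is wanted is known only when the drift leaves the band, so `near_or_between` defers the choice.
The bound `5/6 N` ensures that the first and last crossings also are long enough (`Between.reach`).
-/

/-- A sequence of states and counter values, together with a height such that the drift
`value - N * height` changes by at most one in each step. -/
structure DriftPath (Q : Type*) (N : ℤ) where
  len : ℕ
  state : ℕ → Q
  value : ℕ → ℤ
  height : ℕ → ℤ
  abs_drift_step : ∀ i < len,
    |(value (i + 1) - N * height (i + 1)) - (value i - N * height i)| ≤ 1

namespace DriftPath

variable {Q : Type*} {N : ℤ}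

/-- The part of the counter value that is due to unit updates. -/
def drift (p : DriftPath Q N) (i : ℕ) : ℤ := p.value i - N * p.height i

/-- Either keep the next step of the path, or skip a loop that preserves the height; the
second component records the accumulated effect of the skipped loops. -/
inductive Move (p : DriftPath Q N) (V : ℕ → ℤ → Prop) : ℕ × ℤ → ℕ × ℤ → Prop
  | keep (i : ℕ) (c : ℤ) : i < p.len → V (i + 1) c → Move p V (i, c) (i + 1, c)
  | skip (i j : ℕ) (c : ℤ) : i < j → j ≤ p.len → p.state i = p.state j →
      p.height i = p.height j → V j (c - (p.drift j - p.drift i)) →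
      Move p V (i, c) (j, c - (p.drift j - p.drift i))

/-- Reachability by keeping steps and skipping loops, where `V` constrains the visited pairs. -/
def Reach (p : DriftPath Q N) (V : ℕ → ℤ → Prop) : ℕ × ℤ → ℕ × ℤ → Prop :=
  Relation.ReflTransGen (p.Move V)

theorem reach_keep (p : DriftPath Q N) {V : ℕ → ℤ → Prop} {s t : ℕ} (hst : s ≤ t)
    (ht : t ≤ p.len) {c : ℤ} (hV : ∀ i, s ≤ i → i ≤ t → V i c) : p.Reach V (s, c) (t, c) := by
  induction t, hst using Nat.le_induction with
  | base => exact Relation.ReflTransGen.refl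
  | succ t hst ih =>
    exact (ih (by omega) fun i h1 h2 => hV i h1 (by omega)).tail
      (Move.keep t c (by omega) (hV _ (by omega) le_rfl))

/-- First hitting times of a sequence that increases by at most one in each step. -/
theorem exists_hitting_times {u : ℕ → ℤ} {s t : ℕ} (hst : s ≤ t)
    (hu : ∀ i, s ≤ i → i < t → u (i + 1) ≤ u i + 1) :
    ∃ h : ℕ → ℕ, (∀ x : ℕ, (x : ℤ) ≤ u t - u s → s ≤ h x ∧ h x ≤ t ∧ u (h x) = u s + x) ∧
      ∀ x y : ℕ, x < y → (y : ℤ) ≤ u t - u s → h x < h y := by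
  classical
  have key : ∀ x : ℕ, ∃ m : ℕ, (x : ℤ) ≤ u t - u s →
      s ≤ m ∧ m ≤ t ∧ u m = u s + x ∧ ∀ i, s ≤ i → i < m → u i < u s + x := by
    intro x
    by_cases hx : (x : ℤ) ≤ u t - u s
    · have hex : ∃ m, s ≤ m ∧ u s + x ≤ u m := ⟨t, hst, by linarith⟩
      have hm := Nat.find_spec hex
      have hmin : ∀ i, s ≤ i → i < Nat.find hex → u i < u s + x := by
        intro i h1 h2
        by_contra h3
        exact Nat.find_min hex h2 ⟨h1, not_lt.mp h3⟩
      have hmt : Nat.find hex ≤ t := Nat.find_min' hex ⟨hst, by linarith⟩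
      refine ⟨Nat.find hex, fun _ => ⟨hm.1, hmt, ?_, hmin⟩⟩
      generalize Nat.find hex = m at hm hmin hmt
      rcases hm.1.eq_or_lt with rfl | hlt
      · have := hm.2
        omega
      · obtain ⟨m, rfl⟩ : ∃ m', m = m' + 1 := ⟨m - 1, by omega⟩
        have h1 := hmin m (by omega) (by omega)
        have h2 := hu m (by omega) (by omega)
        have := hm.2
        omega
    · exact ⟨0, fun h => absurd h hx⟩
  choose h hh using key
  refine ⟨h, fun x hx => ⟨(hh x hx).1, (hh x hx).2.1, (hh x hx).2.2.1⟩, fun x y hxy hy => ?_⟩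
  have hy' := hh y hy
  have hx' := hh x (by omega)
  by_contra hle
  rcases (not_lt.mp hle).eq_or_lt with heq | hlt
  · have := hy'.2.2.1
    rw [heq, hx'.2.2.1] at this
    omega
  · have := hx'.2.2.2 _ hy'.1 hlt
    have := hy'.2.2.1
    omega

/-- If the drift changes by a large amount while the height takes few values, then skipping
loops changes the drift by exactly `L * Z`. -/
theorem reach_shift [Fintype Q] (p : DriftPath Q N) {V : ℕ → ℤ → Prop} {ε : ℤ}
    (hε : ε = 1 ∨ ε = -1) {s t : ℕ} (hst : s ≤ t) (ht : t ≤ p.len) {w L Z : ℕ} (hw : 0 < w)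
    (hZ : 0 < Z) (hL : ∀ d, 1 ≤ d → d ≤ w → d ∣ L) {K : Finset ℤ}
    (hK : ∀ i, s ≤ i → i ≤ t → p.height i ∈ K) (hcard : Fintype.card Q * K.card ≤ w)
    (hrise : ((Z * (w * (w * L)) : ℕ) : ℤ) ≤ ε * (p.drift t - p.drift s)) {c : ℤ}
    (hV : ∀ i, s ≤ i → i ≤ t → ∀ e : ℕ, Z ∣ e → e ≤ L * Z → V i (c - ε * e)) :
    p.Reach V (s, c) (t, c - ε * (L * Z : ℕ)) := by
  classical
  have hεε : ε * ε = 1 := by rcases hε with rfl | rfl <;> norm_num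
  obtain ⟨h, hh, hmono⟩ := exists_hitting_times (u := fun i => ε * p.drift i) hst (by
    intro i _ h2
    have := abs_le.mp (p.abs_drift_step i (by omega))
    simp only [drift]
    rcases hε with rfl | rfl <;> linarith [this.1, this.2])
  have hrise' : ∀ x : ℕ, x ≤ w * (w * L) →
      ((Z * x : ℕ) : ℤ) ≤ ε * p.drift t - ε * p.drift s := by
    intro x hx
    have : Z * x ≤ Z * (w * (w * L)) := Nat.mul_le_mul_left _ hx
    have h2 : ((Z * x : ℕ) : ℤ) ≤ ((Z * (w * (w * L)) : ℕ) : ℤ) := by exact_mod_cast this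
    linarith
  set g : ℕ → ℕ := fun x => h (Z * x) with hg
  have hgs : ∀ x ≤ w * (w * L), s ≤ g x := fun x hx => (hh _ (hrise' x hx)).1
  have hgt : ∀ x ≤ w * (w * L), g x ≤ t := fun x hx => (hh _ (hrise' x hx)).2.1
  have hgu : ∀ x ≤ w * (w * L), p.drift (g x) = p.drift s + ε * (Z * x : ℕ) := by
    intro x hx
    have := (hh _ (hrise' x hx)).2.2
    calc p.drift (g x) = ε * (ε * p.drift (g x)) := by rw [← mul_assoc, hεε, one_mul]
      _ = ε * ε * p.drift s + ε * (Z * x : ℕ) := by rw [hg]; simp only [this]; ring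
      _ = _ := by rw [hεε, one_mul]
  have hgm : ∀ x y, x < y → y ≤ w * (w * L) → g x < g y := fun x y hxy hy =>
    hmono _ _ (Nat.mul_lt_mul_of_pos_left hxy hZ) (hrise' y hy)
  have hgm' : ∀ x y, x ≤ y → y ≤ w * (w * L) → g x ≤ g y := by
    intro x y hxy hy
    rcases hxy.eq_or_lt with rfl | hlt
    · exact le_rfl
    · exact (hgm x y hlt hy).le
  -- A block has `w + 1` hitting times, spaced `Z` apart in drift, but at most `w` pairs of state
  -- and height occur.
  have hblock : ∀ r, ∃ ab : ℕ × ℕ, r < w * L → w * r ≤ ab.1 ∧ ab.1 < ab.2 ∧ ab.2 ≤ w * (r + 1) ∧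
      p.state (g ab.1) = p.state (g ab.2) ∧ p.height (g ab.1) = p.height (g ab.2) := by
    intro r
    by_cases hr : r < w * L
    · have hle : w * (r + 1) ≤ w * (w * L) := Nat.mul_le_mul_left _ hr
      obtain ⟨x, hx, y, hy, hxy, heq⟩ := Finset.exists_ne_map_eq_of_card_lt_of_maps_to
        (s := Finset.Icc (w * r) (w * (r + 1))) (t := (Finset.univ : Finset Q) ×ˢ K)
        (f := fun x => (p.state (g x), p.height (g x))) (by
          rw [Finset.card_product, Finset.card_univ, Nat.card_Icc, mul_add]
          omega) (by
          intro x hx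
          have hx' : x ≤ w * (w * L) := (Finset.mem_Icc.mp hx).2.trans hle
          simpa using hK _ (hgs x hx') (hgt x hx'))
      rw [Finset.mem_Icc] at hx hy
      simp only [Prod.mk.injEq] at heq
      rcases lt_or_gt_of_ne hxy with hlt | hlt
      · exact ⟨(x, y), fun _ => ⟨hx.1, hlt, hy.2, heq.1, heq.2⟩⟩
      · exact ⟨(y, x), fun _ => ⟨hy.1, hlt, hx.2, heq.1.symm, heq.2.symm⟩⟩
    · exact ⟨(0, 0), fun h' => absurd h' hr⟩
  choose ab hab using hblock
  -- Second pigeonhole: `w * L` disjoint loops have only `w` possible lengths.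
  obtain ⟨d, hd, hdc⟩ : ∃ d ∈ Finset.Icc 1 w,
      L ≤ ((Finset.range (w * L)).filter fun r => (ab r).2 - (ab r).1 = d).card := by
    refine Finset.exists_le_card_fiber_of_mul_le_card_of_maps_to ?_
      (Finset.nonempty_Icc.mpr hw) (by simp)
    intro r hr
    obtain ⟨h1, h2, h3, -⟩ := hab r (Finset.mem_range.mp hr)
    rw [mul_add] at h3
    rw [Finset.mem_Icc]
    omega
  rw [Finset.mem_Icc] at hd
  obtain ⟨m, hm⟩ := hL d hd.1 hd.2
  have hVm : ∀ i, s ≤ i → i ≤ t → ∀ e ≤ m, V i (c - ε * (Z * d * e : ℕ)) := by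
    intro i h1 h2 e he
    refine hV i h1 h2 _ ⟨d * e, by ring⟩ ?_
    calc Z * d * e ≤ Z * d * m := Nat.mul_le_mul_left _ he
      _ = L * Z := by rw [hm]; ring
  -- Only the first `m = L / d` loops of length `d` are cut; the `min` freezes the correction
  -- afterwards.
  have main : ∀ r ≤ w * L, p.Reach V (s, c) (g (w * r), c - ε * (Z * d *
      min ((Finset.range r).filter fun r => (ab r).2 - (ab r).1 = d).card m : ℕ)) := by
    intro r
    induction r with
    | zero =>
      intro _
      have h0 : w * 0 ≤ w * (w * L) := by simp
      have := p.reach_keep (hgs _ h0) ((hgt _ h0).trans ht) (c := c) (V := V) (by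
        intro i h1 h2
        simpa using hVm i h1 (h2.trans (hgt _ h0)) 0 (Nat.zero_le _))
      simpa using this
    | succ r ih =>
      intro hr
      have ih := ih (by omega)
      have hle : w * (r + 1) ≤ w * (w * L) := Nat.mul_le_mul_left _ hr
      have hle0 : w * r ≤ w * (r + 1) := Nat.mul_le_mul_left _ (by omega)
      obtain ⟨h1, h2, h3, h4, h5⟩ := hab r (by omega)
      rw [Finset.range_add_one, Finset.filter_insert]
      have keep : ∀ x y, x ≤ y → y ≤ w * (w * L) → ∀ e ≤ m,
          p.Reach V (g x, c - ε * (Z * d * e : ℕ)) (g y, c - ε * (Z * d * e : ℕ)) := by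
        intro x y hxy hy e he
        exact p.reach_keep (hgm' x y hxy hy) ((hgt y hy).trans ht) fun i hi1 hi2 =>
          hVm i ((hgs x (hxy.trans hy)).trans hi1) (hi2.trans (hgt y hy)) e he
      set cnt := ((Finset.range r).filter fun r => (ab r).2 - (ab r).1 = d).card with hcnt
      split_ifs with hdr
      · rw [Finset.card_insert_of_notMem (by simp), ← hcnt]
        by_cases hcm : cnt < m
        · rw [min_eq_left hcm.le] at ih
          rw [min_eq_left (by omega)]
          have e1 := keep _ _ h1 (by omega) cnt hcm.le
          have e3 := keep _ _ h3 hle (cnt + 1) hcm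
          have hdrift : c - ε * (Z * d * cnt : ℕ) - (p.drift (g (ab r).2) - p.drift (g (ab r).1))
              = c - ε * (Z * d * (cnt + 1) : ℕ) := by
            rw [hgu _ (by omega), hgu _ (by omega)]
            have : (ab r).2 = (ab r).1 + d := by omega
            rw [this]
            push_cast
            ring
          have e2 := Move.skip (p := p) (V := V) _ _ (c - ε * (Z * d * cnt : ℕ))
            (hgm _ _ h2 (by omega)) ((hgt _ (by omega)).trans ht) h4 h5 (by
              rw [hdrift]
              exact hVm _ (hgs _ (by omega)) (hgt _ (by omega)) _ hcm)
          rw [hdrift] at e2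
          exact ((ih.trans e1).tail e2).trans e3
        · rw [min_eq_right (by omega)] at ih ⊢
          exact ih.trans (keep _ _ hle0 hle m le_rfl)
      · exact ih.trans (keep _ _ hle0 hle _ (min_le_right _ _))
  have hfin := main (w * L) le_rfl
  have hmL : m ≤ L := by
    rw [hm]
    exact Nat.le_mul_of_pos_left _ hd.1
  rw [min_eq_right (hmL.trans hdc)] at hfin
  have hZL : Z * d * m = L * Z := by rw [hm]; ring
  rw [hZL] at hfin
  exact hfin.trans (p.reach_keep (hgt _ le_rfl) ht fun i h1 h2 =>
    hV i ((hgs _ le_rfl).trans h1) h2 _ (dvd_mul_left _ _) le_rfl)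

end DriftPath

end FiveSixth

/-! ### Which corrections keep a value admissible. -/

namespace FiveSixth

/-- Replacing the value `z` by `y` respects divisibility by `Z`, the position relative to `ℓ`,
and the interval `[a, b]` up to `G`. -/
def Admissible (ℓ a b G Z z y : ℤ) : Prop :=
  Z ∣ y - z ∧ ((ℓ < y ↔ ℓ < z) ∧ (ℓ = y ↔ ℓ = z) ∧ (ℓ > y ↔ ℓ > z)) ∧ a - G ≤ y ∧ y ≤ b + G

theorem admissible_of_gt {ℓ a b G Z z y : ℤ} (hd : Z ∣ y - z) (hz : ℓ < z) (hy : ℓ < y)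
    (h1 : a - G ≤ y) (h2 : y ≤ b + G) : Admissible ℓ a b G Z z y :=
  ⟨hd, by omega, h1, h2⟩

theorem admissible_of_lt {ℓ a b G Z z y : ℤ} (hd : Z ∣ y - z) (hz : z < ℓ) (hy : y < ℓ)
    (h1 : a - G ≤ y) (h2 : y ≤ b + G) : Admissible ℓ a b G Z z y :=
  ⟨hd, by omega, h1, h2⟩

/-- The new value is `ℓ + (N - G) * m + w`, so the sign of `m` decides the side of `ℓ`. For `|m| ≤
1` the value moves by at most `G`. For larger `|m|` it moves towards `ℓ` but stays farther out than
`z₀`, which lies in `[a, b]`. -/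
theorem admissible_near {ℓ a b G Z z N E w m z₀ : ℤ} (hG : 0 ≤ G) (hE : G < E) (hN : 30 * E < N)
    (hZ : Z ∣ G) (hz : z = ℓ + N * m + w) (hw1 : -(N - E) ≤ w) (hw2 : w ≤ N - E)
    (ha : a ≤ z) (hb : z ≤ b) (ha0 : a ≤ z₀) (hb0 : z₀ ≤ b) (h1 : 6 * (z₀ - ℓ) ≤ 5 * N)
    (h2 : 6 * (ℓ - z₀) ≤ 5 * N) : Admissible ℓ a b G Z z (z - m * G) := by
  have hd : Z ∣ z - m * G - z := by
    have : z - m * G - z = -m * G := by ring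
    rw [this]
    exact hZ.mul_left _
  have hNG : 0 ≤ N - G := by linarith
  rcases lt_trichotomy m 0 with hm | rfl | hm
  · have e1 : (m + 1) * (N - G) ≤ 0 := mul_nonpos_of_nonpos_of_nonneg (by omega) hNG
    have e2 : (m + 1) * N ≤ 0 := mul_nonpos_of_nonpos_of_nonneg (by omega) (by linarith)
    have e3 : m * G ≤ 0 := mul_nonpos_of_nonpos_of_nonneg hm.le hG
    refine admissible_of_lt hd (by linarith) (by linarith) (by linarith) ?_
    rcases (show m = -1 ∨ m ≤ -2 by omega) with rfl | hm
    · linarith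
    · have e1 : (m + 2) * (N - G) ≤ 0 := mul_nonpos_of_nonpos_of_nonneg (by omega) hNG
      linarith
  · refine ⟨hd, by simp, by linarith, by linarith⟩
  · have e1 : 0 ≤ (m - 1) * (N - G) := mul_nonneg (by omega) hNG
    have e2 : 0 ≤ (m - 1) * N := mul_nonneg (by omega) (by linarith)
    have e3 : 0 ≤ m * G := mul_nonneg hm.le hG
    refine admissible_of_gt hd (by linarith) (by linarith) ?_ (by linarith)
    rcases (show m = 1 ∨ 2 ≤ m by omega) with rfl | hm
    · linarith
    · have e1 : 0 ≤ (m - 2) * (N - G) := mul_nonneg (by omega) hNG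
      linarith

/-- As `w ≥ E > G`, the extra shift `s` cannot push the value across `ℓ`, even when `m = 0`; for `m
= -1` the upper bound on `w` does this. -/
theorem admissible_between {ℓ a b G Z z N E w m s z₀ : ℤ} (hG : 0 ≤ G) (hE : G < E)
    (hN : 30 * E < N) (hZ : Z ∣ G) (hZs : Z ∣ s) (hs0 : 0 ≤ s) (hsG : s ≤ G)
    (hz : z = ℓ + N * m + w) (hw1 : E ≤ w) (hw2 : w ≤ N - E)
    (ha : a ≤ z) (hb : z ≤ b) (ha0 : a ≤ z₀) (hb0 : z₀ ≤ b) (h1 : 6 * (z₀ - ℓ) ≤ 5 * N)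
    (h2 : 6 * (ℓ - z₀) ≤ 5 * N) : Admissible ℓ a b G Z z (z - m * G - s) := by
  have hd : Z ∣ z - m * G - s - z := by
    have : z - m * G - s - z = -m * G - s := by ring
    rw [this]
    exact (hZ.mul_left _).sub hZs
  have hNG : 0 ≤ N - G := by linarith
  rcases lt_or_ge m 0 with hm | hm
  · have e1 : (m + 1) * (N - G) ≤ 0 := mul_nonpos_of_nonpos_of_nonneg (by omega) hNG
    have e2 : (m + 1) * N ≤ 0 := mul_nonpos_of_nonpos_of_nonneg (by omega) (by linarith)
    have e3 : (m + 1) * G ≤ 0 := mul_nonpos_of_nonpos_of_nonneg (by omega) hG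
    refine admissible_of_lt hd (by linarith) (by linarith) (by linarith) ?_
    rcases (show m = -1 ∨ m ≤ -2 by omega) with rfl | hm
    · linarith
    · have e1 : (m + 2) * (N - G) ≤ 0 := mul_nonpos_of_nonpos_of_nonneg (by omega) hNG
      linarith
  · have e1 : 0 ≤ m * (N - G) := mul_nonneg hm hNG
    have e2 : 0 ≤ m * N := mul_nonneg hm (by linarith)
    have e3 : 0 ≤ m * G := mul_nonneg hm hG
    refine admissible_of_gt hd (by linarith) (by linarith) ?_ (by linarith)
    rcases (show m = 0 ∨ 1 ≤ m by omega) with rfl | hm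
    · linarith
    · have e1 : 0 ≤ (m - 1) * (N - G) := mul_nonneg (by omega) hNG
      linarith

/-! ### Following the drift from band to band. -/

namespace DriftPath

variable {Q : Type*} [Fintype Q] {N : ℤ}

/-- Bounds on a path with values in `[a, b] ⊆ [0, 4 * N]` under which the parameter `N` can be
lowered by `L * Z`. -/
structure Bounded (p : DriftPath Q N) (ℓ a b E : ℤ) (w L Z : ℕ) : Prop where
  height_zero : p.height 0 = 0
  nonneg : 0 ≤ a
  le_four : b ≤ 4 * N
  lower : ∀ i ≤ p.len, a ≤ p.value i
  upper : ∀ i ≤ p.len, p.value i ≤ b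
  w_pos : 0 < w
  card_le : Fintype.card Q * 17 ≤ w
  Z_pos : 0 < Z
  dvd_L : ∀ d, 1 ≤ d → d ≤ w → d ∣ L
  gam_lt : ((L * Z : ℕ) : ℤ) < E
  ups_lt : ((Z * (w * (w * L)) : ℕ) : ℤ) < E
  lt_N : 30 * E < N
  start_le : 6 * (p.value 0 - ℓ) ≤ 5 * N
  le_start : 6 * (ℓ - p.value 0) ≤ 5 * N
  end_le : 6 * (p.value p.len - ℓ) ≤ 5 * N
  le_end : 6 * (ℓ - p.value p.len) ≤ 5 * N
  end_sub_start : 6 * (p.value p.len - p.value 0) ≤ 5 * N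
  start_sub_end : 6 * (p.value 0 - p.value p.len) ≤ 5 * N

namespace Bounded

variable {p : DriftPath Q N} {ℓ a b E : ℤ} {w L Z : ℕ}

/-- The pairs that may occur in a compressed path: the new value is admissible. -/
def Ok (p : DriftPath Q N) (ℓ a b : ℤ) (L Z : ℕ) (i : ℕ) (c : ℤ) : Prop :=
  Admissible ℓ a b (L * Z : ℕ) Z (p.value i) (p.value i - p.height i * (L * Z : ℕ) + c)

theorem ok_near (hp : p.Bounded ℓ a b E w L Z) {i : ℕ} (hi : i ≤ p.len) {j : ℤ}
    (h1 : -(N - E) ≤ p.drift i - ℓ - N * j) (h2 : p.drift i - ℓ - N * j ≤ N - E) :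
    Ok p ℓ a b L Z i (-j * (L * Z : ℕ)) := by
  have := admissible_near (ℓ := ℓ) (a := a) (b := b) (G := (L * Z : ℕ)) (Z := Z) (z := p.value i)
    (m := p.height i + j) (w := p.drift i - ℓ - N * j) (by positivity) hp.gam_lt hp.lt_N
    (by push_cast; exact dvd_mul_left _ _) (by rw [drift]; ring) h1 h2 (hp.lower i hi)
    (hp.upper i hi) (hp.lower 0 (Nat.zero_le _)) (hp.upper 0 (Nat.zero_le _)) hp.start_le hp.le_start
  rw [Ok]
  convert this using 1
  ring

theorem ok_between (hp : p.Bounded ℓ a b E w L Z) {i : ℕ} (hi : i ≤ p.len) {j s : ℤ}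
    (h1 : N * j + E ≤ p.drift i - ℓ) (h2 : p.drift i - ℓ ≤ N * j + N - E) (hs : (Z : ℤ) ∣ s)
    (hs0 : 0 ≤ s) (hsG : s ≤ (L * Z : ℕ)) :
    Ok p ℓ a b L Z i (-j * (L * Z : ℕ) - s) := by
  have := admissible_between (ℓ := ℓ) (a := a) (b := b) (G := (L * Z : ℕ)) (Z := Z)
    (z := p.value i) (m := p.height i + j) (w := p.drift i - ℓ - N * j) (by positivity) hp.gam_lt
    hp.lt_N (by push_cast; exact dvd_mul_left _ _) hs hs0 hsG (by rw [drift]; ring)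
    (by linarith) (by linarith) (hp.lower i hi)
    (hp.upper i hi) (hp.lower 0 (Nat.zero_le _)) (hp.upper 0 (Nat.zero_le _)) hp.start_le hp.le_start
  rw [Ok]
  convert this using 1
  ring

/-- Two values in `[0, 4N]` whose drifts share a band of width below `N` differ in height by a
bounded amount; 8 is generous and yields 17 heights. -/
theorem height_mem (hp : p.Bounded ℓ a b E w L Z) {s i : ℕ} (hs : s ≤ p.len) (hi : i ≤ p.len)
    {j : ℤ} (h1 : N * j + E ≤ p.drift i - ℓ) (h2 : p.drift i - ℓ ≤ N * j + N - E)
    (h3 : N * j + E ≤ p.drift s - ℓ) (h4 : p.drift s - ℓ ≤ N * j + N - E) :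
    p.height i ∈ Finset.Icc (p.height s - 8) (p.height s + 8) := by
  have := hp.lower i hi
  have := hp.upper i hi
  have := hp.lower s hs
  have := hp.upper s hs
  have := hp.nonneg
  have := hp.le_four
  have := hp.lt_N
  have hE : 0 < E := lt_of_le_of_lt (by positivity) hp.gam_lt
  simp only [drift] at h1 h2 h3 h4
  rw [Finset.mem_Icc]
  constructor
  · by_contra hlt
    have : 0 ≤ N * (p.height s - 8 - p.height i) := mul_nonneg (by linarith) (by linarith)
    linarith
  · by_contra hlt
    have : 0 ≤ N * (p.height i - (p.height s + 8)) := mul_nonneg (by linarith) (by linarith)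
    linarith

theorem reach_up (hp : p.Bounded ℓ a b E w L Z) {s t : ℕ} (hst : s ≤ t) (ht : t ≤ p.len) {j : ℤ}
    (hz : ∀ i, s ≤ i → i ≤ t → N * j + E ≤ p.drift i - ℓ ∧ p.drift i - ℓ ≤ N * j + N - E)
    (hr : E ≤ p.drift t - p.drift s) :
    p.Reach (Ok p ℓ a b L Z) (s, -j * (L * Z : ℕ)) (t, -(j + 1) * (L * Z : ℕ)) := by
  have := p.reach_shift (V := Ok p ℓ a b L Z) (c := -j * (L * Z : ℕ)) (Or.inl rfl) hst ht hp.w_pos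
    hp.Z_pos hp.dvd_L (K := Finset.Icc (p.height s - 8) (p.height s + 8))
    (fun i h1 h2 => hp.height_mem (hst.trans ht) (h2.trans ht) (hz i h1 h2).1 (hz i h1 h2).2
      (hz s le_rfl hst).1 (hz s le_rfl hst).2) (by
      rw [Int.card_Icc]
      convert hp.card_le using 2
      omega) (by linarith [hp.ups_lt]) (by
      intro i h1 h2 e he1 he2
      rw [one_mul]
      exact hp.ok_between (h2.trans ht) (hz i h1 h2).1 (hz i h1 h2).2 (by exact_mod_cast he1)
        (by positivity) (by exact_mod_cast he2))
  convert this using 2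
  ring

theorem reach_down (hp : p.Bounded ℓ a b E w L Z) {s t : ℕ} (hst : s ≤ t) (ht : t ≤ p.len) {j : ℤ}
    (hz : ∀ i, s ≤ i → i ≤ t → N * j + E ≤ p.drift i - ℓ ∧ p.drift i - ℓ ≤ N * j + N - E)
    (hr : E ≤ p.drift s - p.drift t) :
    p.Reach (Ok p ℓ a b L Z) (s, -(j + 1) * (L * Z : ℕ)) (t, -j * (L * Z : ℕ)) := by
  have := p.reach_shift (V := Ok p ℓ a b L Z) (c := -(j + 1) * (L * Z : ℕ)) (Or.inr rfl) hst ht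
    hp.w_pos hp.Z_pos hp.dvd_L (K := Finset.Icc (p.height s - 8) (p.height s + 8))
    (fun i h1 h2 => hp.height_mem (hst.trans ht) (h2.trans ht) (hz i h1 h2).1 (hz i h1 h2).2
      (hz s le_rfl hst).1 (hz s le_rfl hst).2) (by
      rw [Int.card_Icc]
      convert hp.card_le using 2
      omega) (by linarith [hp.ups_lt]) (by
      intro i h1 h2 e he1 he2
      have he2' : (e : ℤ) ≤ (L * Z : ℕ) := by exact_mod_cast he2
      -- Going down, the correction still missing is measured from the lower multiple, hence `Γ -
      -- e`.
      have := hp.ok_between (h2.trans ht) (hz i h1 h2).1 (hz i h1 h2).2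
        (s := (L * Z : ℕ) - e) (dvd_sub (by push_cast; exact dvd_mul_left _ _)
          (by exact_mod_cast he1)) (by linarith) (by linarith [Int.natCast_nonneg e])
      convert this using 1
      ring)
  convert this using 2
  ring

theorem reach_flat (hp : p.Bounded ℓ a b E w L Z) {s t : ℕ} (hst : s ≤ t) (ht : t ≤ p.len) {j : ℤ}
    (hz : ∀ i, s ≤ i → i ≤ t →
      -(N - E) ≤ p.drift i - ℓ - N * j ∧ p.drift i - ℓ - N * j ≤ N - E) :
    p.Reach (Ok p ℓ a b L Z) (s, -j * (L * Z : ℕ)) (t, -j * (L * Z : ℕ)) :=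
  p.reach_keep hst ht fun i h1 h2 => hp.ok_near (h2.trans ht) (hz i h1 h2).1 (hz i h1 h2).2

/-- The drift has stayed between two multiples of `N` since time `s`, at which it was close to
the multiple currently in use, or which is the start. -/
def Between (p : DriftPath Q N) (ℓ a b E : ℤ) (L Z : ℕ) (t : ℕ) (j : ℤ) : Prop :=
  ∃ s ≤ t, (∀ i, s ≤ i → i ≤ t → N * j + E ≤ p.drift i - ℓ ∧ p.drift i - ℓ ≤ N * j + N - E) ∧
    ((s = 0 ∧ (j = 0 ∨ j = -1)) ∨
    (p.drift s - ℓ = N * j + E ∧ p.Reach (Ok p ℓ a b L Z) (0, 0) (s, -j * (L * Z : ℕ))) ∨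
    (p.drift s - ℓ = N * j + N - E ∧
      p.Reach (Ok p ℓ a b L Z) (0, 0) (s, -(j + 1) * (L * Z : ℕ))))

/-- `J` can only be one of the two multiples bounding the band. If it is the one in use, no loop is
cut. Otherwise the drift has travelled at least `N / 6 - E > E`, measured from the start or from the
edge of the band, which suffices for a shift. -/
theorem Between.reach (hp : p.Bounded ℓ a b E w L Z) {t : ℕ} (ht : t ≤ p.len) {j J : ℤ}
    (hB : Between p ℓ a b E L Z t j) (h1 : 6 * (p.drift t - ℓ - N * J) ≤ 5 * N)
    (h2 : -(5 * N) ≤ 6 * (p.drift t - ℓ - N * J))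
    (h3 : 6 * (p.drift t - N * J - p.drift 0) ≤ 5 * N + 6 * E)
    (h4 : -(5 * N + 6 * E) ≤ 6 * (p.drift t - N * J - p.drift 0)) :
    p.Reach (Ok p ℓ a b L Z) (0, 0) (t, -J * (L * Z : ℕ)) := by
  obtain ⟨s, hst, hz, hcase⟩ := hB
  have hE : 0 < E := lt_of_le_of_lt (by positivity) hp.gam_lt
  have hN := hp.lt_N
  have hJ : J = j ∨ J = j + 1 := by
    have ht' := hz t hst le_rfl
    by_contra hne
    rcases (show J ≤ j - 1 ∨ j + 2 ≤ J by omega) with h | h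
    · have : 0 ≤ N * (j - 1 - J) := mul_nonneg (by linarith) (by linarith)
      linarith
    · have : 0 ≤ N * (J - (j + 2)) := mul_nonneg (by linarith) (by linarith)
      linarith
  have flat0 := hp.reach_flat hst ht (j := j) fun i hi1 hi2 => by
    constructor <;> linarith [(hz i hi1 hi2).1, (hz i hi1 hi2).2]
  have flat1 := hp.reach_flat hst ht (j := j + 1) fun i hi1 hi2 => by
    constructor <;> linarith [(hz i hi1 hi2).1, (hz i hi1 hi2).2]
  rcases hcase with ⟨rfl, rfl | rfl⟩ | ⟨hs, hR⟩ | ⟨hs, hR⟩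
  · rw [neg_zero, zero_mul] at flat0
    rcases hJ with rfl | rfl
    · simpa using flat0
    · have := hp.reach_up hst ht hz (by linarith)
      rwa [neg_zero, zero_mul] at this
  · rw [neg_add_cancel, neg_zero, zero_mul] at flat1
    rcases hJ with rfl | rfl
    · have := hp.reach_down hst ht hz (by linarith)
      rwa [neg_add_cancel, neg_zero, zero_mul] at this
    · simpa using flat1
  · rcases hJ with rfl | rfl
    · exact hR.trans flat0
    · exact hR.trans (hp.reach_up hst ht hz (by linarith))
  · rcases hJ with rfl | rfl
    · exact hR.trans (hp.reach_down hst ht hz (by linarith))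
    · exact hR.trans flat1

/-- Inside a band only the entry point is recorded, since the side of exit is not yet known. -/
theorem near_or_between (hp : p.Bounded ℓ a b E w L Z) {t : ℕ} (ht : t ≤ p.len) :
    (∃ j, -E ≤ p.drift t - ℓ - N * j ∧ p.drift t - ℓ - N * j ≤ E ∧
      p.Reach (Ok p ℓ a b L Z) (0, 0) (t, -j * (L * Z : ℕ))) ∨
    ∃ j, Between p ℓ a b E L Z t j := by
  have hE : 0 < E := lt_of_le_of_lt (by positivity) hp.gam_lt
  have hN := hp.lt_N
  have h0 : p.drift 0 = p.value 0 := by rw [drift, hp.height_zero]; ring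
  have hs1 := hp.start_le
  have hs2 := hp.le_start
  rw [← h0] at hs1 hs2
  induction t with
  | zero =>
    by_cases h1 : p.drift 0 - ℓ < -E
    · refine Or.inr ⟨-1, 0, le_rfl, fun i hi1 hi2 => ?_, Or.inl ⟨rfl, Or.inr rfl⟩⟩
      obtain rfl : i = 0 := by omega
      constructor <;> linarith
    by_cases h2 : E < p.drift 0 - ℓ
    · refine Or.inr ⟨0, 0, le_rfl, fun i hi1 hi2 => ?_, Or.inl ⟨rfl, Or.inl rfl⟩⟩
      obtain rfl : i = 0 := by omega
      constructor <;> linarith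
    refine Or.inl ⟨0, by linarith, by linarith, ?_⟩
    rw [neg_zero, zero_mul]
    exact Relation.ReflTransGen.refl
  | succ t ih =>
    have hstep := abs_le.mp (p.abs_drift_step t (by omega))
    change -1 ≤ p.drift (t + 1) - p.drift t ∧ p.drift (t + 1) - p.drift t ≤ 1 at hstep
    have near : ∀ j, -E ≤ p.drift t - ℓ - N * j → p.drift t - ℓ - N * j ≤ E →
        p.Reach (Ok p ℓ a b L Z) (0, 0) (t, -j * (L * Z : ℕ)) →
        (∃ j, -E ≤ p.drift (t + 1) - ℓ - N * j ∧ p.drift (t + 1) - ℓ - N * j ≤ E ∧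
          p.Reach (Ok p ℓ a b L Z) (0, 0) (t + 1, -j * (L * Z : ℕ))) ∨
        ∃ j, Between p ℓ a b E L Z (t + 1) j := by
      intro j h1 h2 hR
      -- Unit steps force the drift to equal `±E` exactly when it leaves, so the band is entered at
      -- time `t`, on its edge.
      by_cases h3 : p.drift (t + 1) - ℓ - N * j < -E
      · refine Or.inr ⟨j - 1, t, by omega, fun i hi1 hi2 => ?_, Or.inr (Or.inr ⟨?_, ?_⟩)⟩
        · rcases (show i = t ∨ i = t + 1 by omega) with rfl | rfl <;> constructor <;> linarith
        · have : p.drift t - ℓ - N * j = -E := by omega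
          linarith
        · rwa [sub_add_cancel]
      by_cases h4 : E < p.drift (t + 1) - ℓ - N * j
      · refine Or.inr ⟨j, t, by omega, fun i hi1 hi2 => ?_, Or.inr (Or.inl ⟨?_, hR⟩)⟩
        · rcases (show i = t ∨ i = t + 1 by omega) with rfl | rfl <;> constructor <;> linarith
        · have : p.drift t - ℓ - N * j = E := by omega
          linarith
      refine Or.inl ⟨j, by linarith, by linarith, hR.tail (Move.keep t _ (by omega) ?_)⟩
      exact hp.ok_near ht (by linarith) (by linarith)
    rcases ih (by omega) with ⟨j, h1, h2, hR⟩ | ⟨j, hB⟩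
    · exact near j h1 h2 hR
    · have hB' := hB
      obtain ⟨s, hst, hz, hcase⟩ := hB
      have hz0 := hz t hst le_rfl
      by_cases h1 : p.drift (t + 1) - ℓ < N * j + E
      · have heq : p.drift t - ℓ - N * j = E := by
          generalize N * j = x at *
          omega
        exact near j (by linarith) (by linarith) (hB'.reach hp (by omega) (by linarith)
          (by linarith) (by linarith) (by linarith))
      by_cases h2 : N * j + N - E < p.drift (t + 1) - ℓ
      · have heq : p.drift t - ℓ - N * (j + 1) = -E := by
          rw [mul_add, mul_one]
          generalize N * j = x at *
          omega
        exact near (j + 1) (by linarith) (by linarith) (hB'.reach hp (by omega) (by linarith)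
          (by linarith) (by linarith) (by linarith))
      refine Or.inr ⟨j, s, by omega, fun i hi1 hi2 => ?_, hcase⟩
      rcases (show i ≤ t ∨ i = t + 1 by omega) with h | rfl
      · exact hz i hi1 h
      · exact ⟨not_lt.mp h1, not_lt.mp h2⟩

/-- At the end `d - ℓ = N * (-h) + (z - ℓ)` with `|z - ℓ| ≤ 5/6 N`, so the multiple wanted is `-h`.
-/
theorem reach_end (hp : p.Bounded ℓ a b E w L Z) :
    p.Reach (Ok p ℓ a b L Z) (0, 0) (p.len, p.height p.len * (L * Z : ℕ)) := by
  have hE : 0 < E := lt_of_le_of_lt (by positivity) hp.gam_lt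
  have hN := hp.lt_N
  have h0 : p.drift 0 = p.value 0 := by rw [drift, hp.height_zero]; ring
  have hn : p.drift p.len - N * -p.height p.len = p.value p.len := by rw [drift]; ring
  have e1 := hp.end_le
  have e2 := hp.le_end
  have e3 := hp.end_sub_start
  have e4 := hp.start_sub_end
  rw [← hn] at e1 e2 e3 e4
  rcases hp.near_or_between le_rfl with ⟨j, h1, h2, hR⟩ | ⟨j, hB⟩
  · have : j = -p.height p.len := by
      by_contra hne
      rcases lt_or_gt_of_ne hne with h | h
      · have : 0 ≤ N * (-p.height p.len - 1 - j) := mul_nonneg (by linarith) (by linarith)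
        linarith
      · have : 0 ≤ N * (j - 1 - -p.height p.len) := mul_nonneg (by linarith) (by linarith)
        linarith
    rwa [this, neg_neg] at hR
  · have := hB.reach hp le_rfl (J := -p.height p.len) (by linarith) (by linarith) (by linarith)
      (by linarith)
    rwa [neg_neg] at this

end Bounded

end DriftPath

end FiveSixth

/-! ### From drift paths back to semiruns. -/

namespace FiveSixth

/-- The number of times that an operation adds a parameter. -/
def Op.height {P : Type*} : Op P → ℤ
  | .addParam _ => 1
  | .subParam _ => -1
  | _ => 0

theorem lcmSet_pos (S : Finset ℕ) : 0 < lcmSet S := by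
  refine Nat.pos_of_ne_zero fun h => ?_
  obtain ⟨x, hx, h0⟩ := Finset.lcm_eq_zero_iff.mp h
  simp_all

theorem dvd_lcmSet {S : Finset ℕ} {x : ℕ} (hx : x ∈ S) (h0 : x ≠ 0) : x ∣ lcmSet S :=
  Finset.dvd_lcm (f := id) (Finset.mem_erase.mpr ⟨h0, hx⟩)

theorem dvd_lcmUpTo {d j : ℕ} (h1 : 1 ≤ d) (h2 : d ≤ j) : d ∣ lcmUpTo j :=
  dvd_lcmSet (Finset.mem_Icc.mpr ⟨h1, h2⟩) (by omega)

namespace POCA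

variable {Q P : Type*}

theorem OpSemiStep.abs_le_one {N : ℕ} {op : Op P} {z z' : ℤ}
    (h : OpSemiStep (fun _ : P => N) op z z') : |z' - z - N * op.height| ≤ 1 := by
  cases op with
  | upd c =>
    simp only [OpSemiStep] at h
    subst h
    cases c <;> simp [Op.height]
  | addParam p => simp only [OpSemiStep] at h; subst h; simp [Op.height]
  | subParam p => simp only [OpSemiStep] at h; subst h; simp [Op.height]
  | modTest c => simp only [OpSemiStep] at h; simp [Op.height, h.1]
  | cmpConst r c => simp only [OpSemiStep] at h; simp [Op.height, h]
  | cmpParam r p => simp only [OpSemiStep] at h; simp [Op.height, h]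

theorem dvd_Z {C : POCA Q P} {q q' : Q} {c : ℕ} (h : (q, Op.modTest c, q') ∈ C.rules)
    (h0 : c ≠ 0) : c ∣ C.Z :=
  dvd_lcmSet (Finset.mem_biUnion.mpr ⟨_, h, by simp [Op.consts]⟩) h0

/-- A semitransition may be shifted by a multiple of `Z_C`, while the parameter is changed. -/
theorem SemiStep.shift {C : POCA Q P}
    (hmod : ∀ (q : Q) (c : ℕ) (q' : Q), (q, Op.modTest c, q') ∈ C.rules → c ≠ 0)
    {N N' : ℕ} {op : Op P} {q q' : Q} {z z' y y' : ℤ}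
    (h : C.SemiStep (fun _ => N) op (q, z) (q', z')) (hd : (C.Z : ℤ) ∣ y' - z')
    (hy : y' - y = z' - z - (N - N') * op.height) :
    C.SemiStep (fun _ => N') op (q, y) (q', y') := by
  obtain ⟨hr, h⟩ := h
  refine ⟨hr, ?_⟩
  cases op with
  | upd c => simp only [OpSemiStep, Op.height] at *; linarith
  | addParam p => simp only [OpSemiStep, Op.height] at *; linarith
  | subParam p => simp only [OpSemiStep, Op.height] at *; linarith
  | modTest c =>
    simp only [OpSemiStep, Op.height] at *
    refine ⟨by linarith, ?_⟩
    have hc : (c : ℤ) ∣ C.Z := by exact_mod_cast dvd_Z hr (hmod _ _ _ hr)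
    have := dvd_add (hc.trans hd) h.2
    rwa [sub_add_cancel] at this
  | cmpConst r c => simp only [OpSemiStep, Op.height] at *; linarith
  | cmpParam r p => simp only [OpSemiStep, Op.height] at *; linarith

end POCA

namespace Semirun

variable {Q P : Type*} {C : POCA Q P} {N : ℕ}

/-- The configurations, indexed by the natural numbers. -/
def natConf {μ : P → ℕ} (π : Semirun C μ) (i : ℕ) : Q × ℤ :=
  π.conf ⟨Min.min i π.len, by omega⟩

/-- The operations, indexed by the natural numbers. -/
def natOp {μ : P → ℕ} (π : Semirun C μ) (i : ℕ) : Op P :=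
  if h : i < π.len then π.op ⟨i, h⟩ else .upd 0

theorem natConf_eq {μ : P → ℕ} (π : Semirun C μ) {i : ℕ} (hi : i < π.len + 1) :
    π.natConf i = π.conf ⟨i, hi⟩ := by
  rw [natConf]
  congr 2
  omega

theorem natStep {μ : P → ℕ} (π : Semirun C μ) {i : ℕ} (hi : i < π.len) :
    C.SemiStep μ (π.natOp i) (π.natConf i) (π.natConf (i + 1)) := by
  rw [π.natConf_eq (by omega), π.natConf_eq (by omega), natOp, dif_pos hi]
  exact π.step ⟨i, hi⟩

theorem natConf_mem {μ : P → ℕ} (π : Semirun C μ) (i : ℕ) : (π.natConf i).2 ∈ π.values :=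
  Finset.mem_image_of_mem _ (Finset.mem_univ _)

/-- The path of states and values of a semirun, with its parametric updates as height. -/
def driftPath (π : Semirun C (fun _ : P => N)) : DriftPath Q N where
  len := π.len
  state i := (π.natConf i).1
  value i := (π.natConf i).2
  height i := ∑ x ∈ Finset.range i, (π.natOp x).height
  abs_drift_step i hi := by
    have := (π.natStep hi).2.abs_le_one
    rw [Finset.sum_range_succ]
    convert this using 2
    ring

open DriftPath.Bounded in
/-- A compressed path can be realised by a semirun for a smaller parameter. -/
theorem exists_of_reach
    (hmod : ∀ (q : Q) (c : ℕ) (q' : Q), (q, Op.modTest c, q') ∈ C.rules → c ≠ 0)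
    (π : Semirun C (fun _ : P => N)) {ℓ a b : ℤ} {L N' : ℕ} (hN : N = N' + L * C.Z)
    (ha : ∀ i, a ≤ π.driftPath.value i) (hb : ∀ i, π.driftPath.value i ≤ b)
    {ic : ℕ × ℤ} (h : π.driftPath.Reach (Ok π.driftPath ℓ a b L C.Z) (0, 0) ic) :
    ic.1 ≤ π.len ∧ ∃ (m : ℕ) (cf : ℕ → Q × ℤ) (op : ℕ → Op P) (ψ : ℕ → ℕ),
      cf 0 = π.natConf 0 ∧ cf m = ((π.natConf ic.1).1,
        (π.natConf ic.1).2 - π.driftPath.height ic.1 * (L * C.Z : ℕ) + ic.2) ∧ ψ m = ic.1 ∧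
      (∀ x < m, C.SemiStep (fun _ => N') (op x) (cf x) (cf (x + 1)) ∧ ψ x < ψ (x + 1) ∧
        op x = π.natOp (ψ x)) ∧
      ∀ x ≤ m, Admissible ℓ a b (L * C.Z : ℕ) C.Z (π.natConf (ψ x)).2 (cf x).2 := by
  induction h with
  | refl =>
    refine ⟨Nat.zero_le _, 0, fun _ => π.natConf 0, fun _ => .upd 0, fun _ => 0, rfl, ?_, rfl,
      fun x hx => absurd hx (Nat.not_lt_zero _), fun x _ => ⟨by simp, by simp, ?_, ?_⟩⟩
    · simp [driftPath]
    · have : (0 : ℤ) ≤ (L * C.Z : ℕ) := by positivity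
      linarith [show a ≤ (π.natConf 0).2 from ha 0]
    · have : (0 : ℤ) ≤ (L * C.Z : ℕ) := by positivity
      linarith [show (π.natConf 0).2 ≤ b from hb 0]
  | tail _ hmove ih =>
    obtain ⟨hle, m, cf, op, ψ, h0, hm, hψ, hstep, hadm⟩ := ih
    cases hmove with
    | keep i c hi hV =>
      simp only at hψ hm
      refine ⟨hi, m + 1, fun x => if x ≤ m then cf x else ((π.natConf (i + 1)).1,
        (π.natConf (i + 1)).2 - π.driftPath.height (i + 1) * (L * C.Z : ℕ) + c),
        fun x => if x < m then op x else π.natOp i, fun x => if x ≤ m then ψ x else i + 1,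
        by simpa using h0, by simp, by simp, fun x hx => ?_, fun x hx => ?_⟩
      · rcases (show x < m ∨ x = m by omega) with h | rfl
        · have h' : x ≤ m := h.le
          have h'' : x + 1 ≤ m := h
          simpa [h, h', h''] using hstep x h
        · simp only [le_refl, if_true, lt_irrefl, if_false, hψ, hm,
            show ¬ (x + 1 ≤ x) by omega, and_true]
          refine ⟨(π.natStep hi).shift hmod hV.1 ?_, by omega⟩
          have hN' : (N : ℤ) - N' = (L * C.Z : ℕ) := by omega
          rw [hN']
          simp only [driftPath, Finset.sum_range_succ, natConf]
          ring
      · rcases (show x ≤ m ∨ x = m + 1 by omega) with h | rfl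
        · simpa [h] using hadm x h
        · simp only [show ¬ (m + 1 ≤ m) by omega, if_false]
          exact hV
    | skip i j c hij hj hs hh hV =>
      simp only at hψ hm
      -- A cut loop adds no configuration: the last one is merely reassigned from index `i` to `j`.
      have hend : cf m = ((π.natConf j).1, (π.natConf j).2 -
          π.driftPath.height j * (L * C.Z : ℕ) + (c - (π.driftPath.drift j - π.driftPath.drift i))) := by
        rw [hm]
        refine Prod.ext hs ?_
        simp only [DriftPath.drift]
        change _ = _ + (c - (((π.natConf j).2 - _) - ((π.natConf i).2 - _)))
        rw [hh]
        ring
      refine ⟨hj, m, cf, op, fun x => if x < m then ψ x else j, h0, hend, by simp,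
        fun x hx => ?_, fun x hx => ?_⟩
      · obtain ⟨h1, h2, h3⟩ := hstep x hx
        refine ⟨h1, ?_, by simpa [hx] using h3⟩
        simp only [hx, if_true]
        split_ifs with h
        · exact h2
        · have : x + 1 = m := by omega
          rw [this, hψ] at h2
          omega
      · rcases hx.lt_or_eq with h | rfl
        · simpa [h] using hadm x hx
        · simp only [lt_irrefl, if_false, hend]
          exact hV

end Semirun

end FiveSixth

/-! ### Assembly. -/

open FiveSixth in
theorem mainTheorem4 {Q P : Type*} [Fintype Q] [Unique P] (C : FiveSixth.POCA Q P)
    (hmod : ∀ (q : Q) (c : ℕ) (q' : Q), (q, FiveSixth.Op.modTest c, q') ∈ C.rules → c ≠ 0)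
    (N : ℕ) (hN : C.M < N) (ℓ : ℤ) (π : FiveSixth.NSemirun C N)
    (hval : π.values ⊆ Finset.Icc 0 (4 * (N : ℤ)))
    (hdist : ((max (max π.source.2 π.target.2) ℓ - min (min π.source.2 π.target.2) ℓ : ℤ) : ℚ)
      ≤ 5 / 6 * (N : ℚ)) :
    ∃ π' : FiveSixth.NSemirun C (N - C.Gam),
      π'.source = π.source ∧ π'.target = π.target ∧
      FiveSixth.Semirun.IsEmbedding ℓ π' π ∧
      π'.values ⊆ Finset.Icc (π.min - (C.Gam : ℤ)) (π.max + (C.Gam : ℤ)) := by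
  classical
  have hcard : 0 < Fintype.card Q := Fintype.card_pos_iff.mpr ⟨(π.conf 0).1⟩
  have hZ : 0 < C.Z := lcmSet_pos _
  have hM : 30 * (C.Ups + C.Gam + 1) < N := hN
  have hups : C.Z * (17 * Fintype.card Q * (17 * Fintype.card Q *
      lcmUpTo (17 * Fintype.card Q))) ≤ C.Ups := by
    calc _ = 17 * Fintype.card Q * lcmUpTo (17 * Fintype.card Q) *
          (17 * Fintype.card Q * C.Z) := by ring
      _ ≤ _ := Nat.mul_le_mul_left _ (Nat.le_add_right _ 2)
  have hlo : ∀ i, π.min ≤ (π.natConf i).2 := fun i => Finset.min'_le _ _ (π.natConf_mem i)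
  have hhi : ∀ i, (π.natConf i).2 ≤ π.max := fun i => Finset.le_max' _ _ (π.natConf_mem i)
  have hmin := (Finset.mem_Icc.mp (hval (Finset.min'_mem _ π.values_nonempty))).1
  have hmax := (Finset.mem_Icc.mp (hval (Finset.max'_mem _ π.values_nonempty))).2
  have hsrc : π.natConf 0 = π.source := π.natConf_eq (by omega)
  have htgt : π.natConf π.len = π.target := π.natConf_eq (by omega)
  have hdist' : 6 * (max (max π.source.2 π.target.2) ℓ - min (min π.source.2 π.target.2) ℓ)
      ≤ 5 * (N : ℤ) := by
    rw [← Int.cast_le (R := ℚ), Int.cast_mul, Int.cast_mul, Int.cast_natCast]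
    push_cast at hdist ⊢
    linarith
  -- The margin `E = Υ + Γ + 1` strictly exceeds both `Γ` and the rise needed for a shift, and `M =
  -- 30 * E`.
  have hp : π.driftPath.Bounded ℓ π.min π.max (C.Ups + C.Gam + 1 : ℕ) (17 * Fintype.card Q)
      (lcmUpTo (17 * Fintype.card Q)) C.Z := by
    have h0 : π.driftPath.value 0 = π.source.2 := congrArg Prod.snd hsrc
    have hn : π.driftPath.value π.driftPath.len = π.target.2 := congrArg Prod.snd htgt
    refine ⟨by simp [Semirun.driftPath], hmin, hmax, fun i _ => hlo i, fun i _ => hhi i, by omega,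
      by omega, hZ, fun d h1 h2 => dvd_lcmUpTo h1 h2, ?_, ?_, by exact_mod_cast hM, ?_, ?_, ?_, ?_,
      ?_, ?_⟩
    · have : lcmUpTo (17 * Fintype.card Q) * C.Z < C.Ups + C.Gam + 1 := by
        change C.Gam < _
        omega
      exact_mod_cast this
    · have := Nat.lt_of_le_of_lt hups (show C.Ups < C.Ups + C.Gam + 1 by omega)
      exact_mod_cast this
    all_goals simp only [h0, hn]; omega
  obtain ⟨-, m, cf, op, ψ, h0, hm, hψ, hstep, hadm⟩ := π.exists_of_reach hmod
    (N' := N - C.Gam) (L := lcmUpTo (17 * Fintype.card Q))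
    (show N = N - C.Gam + C.Gam by omega) hlo hhi hp.reach_end
  -- The final correction `h * Γ` cancels the loss from the smaller parameter.
  have hm' : cf m = π.target := by
    rw [hm, ← htgt, sub_add_cancel]
    rfl
  have hmono : ∀ x y, x < y → y ≤ m → ψ x < ψ y := by
    intro x y hxy
    induction y, hxy using Nat.le_induction with
    | base => exact fun h => (hstep x h).2.1
    | succ y _ ih => exact fun h => (ih (by omega)).trans (hstep y h).2.1
  have hψle : ∀ x ≤ m, ψ x ≤ π.len := by
    intro x hx
    rw [show π.len = ψ m from hψ.symm]
    rcases hx.lt_or_eq with h | rfl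
    · exact (hmono _ _ h le_rfl).le
    · exact le_rfl
  refine ⟨⟨m, fun i => cf i, fun i => op i, fun i => (hstep i i.2).1⟩, h0.trans hsrc, hm',
    ⟨congrArg Prod.fst (h0.trans hsrc), congrArg Prod.fst hm',
      fun i => ⟨ψ i, Nat.lt_succ_of_le (hψle i (Nat.le_of_lt_succ i.2))⟩,
      fun i j hij => hmono _ _ hij (Nat.le_of_lt_succ j.2), fun i => ?_, fun i => ?_⟩, ?_⟩
  · have hlt : ψ i < π.len :=
      Nat.lt_of_lt_of_le (hmono i (i + 1) (Nat.lt_succ_self _) i.2) (hψle _ i.2)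
    refine ⟨⟨ψ i, hlt⟩, rfl, ?_⟩
    have := (hstep i i.2).2.2
    rwa [Semirun.natOp, dif_pos hlt] at this
  · have hi := Nat.le_of_lt_succ i.2
    have := (hadm i hi).2.1
    rwa [π.natConf_eq (Nat.lt_succ_of_le (hψle i hi))] at this
  · intro v hv
    obtain ⟨i, -, rfl⟩ := Finset.mem_image.mp hv
    exact Finset.mem_Icc.mpr (hadm i (Nat.le_of_lt_succ i.2)).2.2
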